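/- Conventions. Graphs are simple, and families of graphs are considered up to isomorphism. For a graph $G=(V,E)$, a vertex $x$ and $r\in\mathbb N=\{0,1,\dots\}$, let $N_G^{\le r}(x)$ be the set of vertices at distance at most $r$ from $x$. For a labelling $\ell$ of $V$, the *$r$-ball of $x$ in $(G,\ell)$* is the labelled graph induced on $N_G^{\le r}(x)$, rooted at $x$. An *$r$-local rule* $A$ assigns a value $A(G,\ell)(x)$ to each vertex $x$ of each labelled graph $(G,\ell)$, in such a way that this value depends only on the isomorphism type of the $r$-ball of $x$ in $(G,\ell)$ as a rooted labelled graph. An *LCL* (on unlabelled graphs) is a $\{0,1\}$-valued $t$-local rule $C$, for some $t\in\mathbb N$, on graphs labelled by natural numbers; an assignment $a:V\to\mathbb N$ *solves* $C$ on $G$ if $C(G,a)(x)=1$ for every $x\in V$. For a family $\mathcal H$ of graphs, an LCL $C$ and $n\in\mathbb N$, the deterministic LOCAL complexity $\mathrm{Det}_{C,\mathcal H}(n)\in\mathbb N\cup\{\infty\}$ is the smallest $r$ for which there is an $r$-local rule $A$ with values in $\mathbb N$ (which may depend on $n$) such that, for every $G=(V,E)\in\mathcal H$ with exactly $n$ vertices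 and every bijection $\ell:V\to\{0,\dots,n-1\}$, the assignment $A(G,\ell)$ solves $C$ on $G$; it is $\infty$ if there is no such $r$. A *Borel graph* is a graph $\mathcal G=(V,E)$ whose vertex set $V$ is a standard Borel space and whose edge set $E$ is, as a symmetric relation, a Borel subset of $V\times V$. **Theorem 10.1 (Bernshteyn).** Let $d\in\mathbb N$ and let $\mathcal H$ be a family of graphs such that every vertex of every graph in $\mathcal H$ has degree at most $d$, and such that adding an isolated vertex to a graph in $\mathcal H$ gives a graph in $\mathcal H$. Let $C$ be an LCL on unlabelled graphs such that $\mathrm{Det}_{C,\mathcal H}(n)=o(\log n)$ as $n\to\infty$ (in particular, $\mathrm{Det}_{C,\mathcal H}(n)$ is finite for all large $n$). Let $\mathcal G=(V,E)$ be a Borel graph such that, for every $x\in V$ and every $r\in\mathbb N$, the subgraph of $\mathcal G$ induced by $N_{\mathcal G}^{\le r}(x)$ belongs to $\mathcal H$. Then there is a Borel function $a:V\to\mathbb N$ that solves $C$ on $\mathcal G$. -/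

import Mathlib

open Filter Asymptotics
open scoped SimpleGraph

universe u

namespace LocalBorel

/-- The closed `r`-ball around `x`: all vertices at graph distance at most `r` from `x`
(vertices of other components are at infinite distance). -/
def closedBall {V : Type u} (G : SimpleGraph V) (x : V) (r : ℕ) : Set V :=
  {y | G.edist x y ≤ r}

theorem center_mem {V : Type u} (G : SimpleGraph V) (x : V) (r : ℕ) :
    x ∈ closedBall G x r := by
  simp [closedBall]

/-- The subgraph of `G` induced by the closed `r`-ball around `x`. -/
abbrev ballGraph {V : Type u} (G : SimpleGraph V) (x : V) (r : ℕ) :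
    SimpleGraph (closedBall G x r) :=
  G.induce (closedBall G x r)

/-- The rooted labelled graphs induced by the `r`-balls around `x` in `(G, l)` and around `y` in
`(H, m)` are isomorphic: there is a graph isomorphism preserving the root and the labels. -/
def SameBall {L : Type*} {V W : Type u} (r : ℕ) (G : SimpleGraph V) (l : V → L) (x : V)
    (H : SimpleGraph W) (m : W → L) (y : W) : Prop :=
  ∃ e : ballGraph G x r ≃g ballGraph H y r,
    e ⟨x, center_mem G x r⟩ = ⟨y, center_mem H y r⟩ ∧
    ∀ v : closedBall G x r, m (e v : W) = l (v : V)

/-- A local rule of radius `r` with labels in `L` and values in `O`: it assigns a value to each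
vertex of each `L`-labelled graph, and this value depends only on the isomorphism type of the
rooted labelled graph induced by the `r`-ball around the vertex. -/
structure LocalRule (L O : Type) (r : ℕ) where
  /-- the value at the vertex `x` of the graph `G` with the labelling `l` -/
  eval : ∀ {V : Type u}, SimpleGraph V → (V → L) → V → O
  /-- the value depends only on the isomorphism type of the `r`-ball -/
  eval_eq : ∀ {V W : Type u} (G : SimpleGraph V) (l : V → L) (x : V)
    (H : SimpleGraph W) (m : W → L) (y : W),
    SameBall r G l x H m y → eval G l x = eval H m y

/-- A locally checkable labelling problem on unlabelled graphs: a `{0,1}`-valued local rule that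
is applied to a graph together with an assignment of natural numbers to its vertices. -/
structure LCL where
  /-- the radius of the problem -/
  radius : ℕ
  /-- the rule that checks the constraint at each vertex -/
  rule : LocalRule.{u} ℕ Bool radius

/-- The assignment `a` solves the problem `C` on `G`: the constraint holds at every vertex. -/
def LCL.Solves (C : LCL.{u}) {V : Type u} (G : SimpleGraph V) (a : V → ℕ) : Prop :=
  ∀ x : V, C.rule.eval G a x = true

/-- A family of graphs. -/
abbrev GraphFamily := ∀ ⦃V : Type u⦄, SimpleGraph V → Prop

/-- All degrees of all graphs in the family are at most `d`. -/
def DegreesBounded (𝓗 : GraphFamily.{u}) (d : ℕ) : Prop :=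
  ∀ {V : Type u} (G : SimpleGraph V), 𝓗 G → ∀ x : V, (G.neighborSet x).encard ≤ d

/-- Adding one (hence any finite number of) isolated vertices to a graph of the family gives a
graph of the family. -/
def ClosedUnderIsolated (𝓗 : GraphFamily.{u}) : Prop :=
  ∀ {V : Type u} (G : SimpleGraph V), 𝓗 G → 𝓗 (G ⊕g (⊥ : SimpleGraph PUnit.{u + 1}))

/-- The rule `A` of radius `r`, run on an order-`n` graph whose vertices carry identifiers, solves
`C` on every graph of order `n` in the family, for every bijection from the vertex set to
`{0, …, n - 1}` used as the identifiers. -/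
def SolvesAll (C : LCL.{u}) (𝓗 : GraphFamily.{u}) (n : ℕ) {r : ℕ}
    (A : LocalRule.{u} (Fin n) ℕ r) : Prop :=
  ∀ {V : Type u} (G : SimpleGraph V) (l : V ≃ Fin n), 𝓗 G → C.Solves G (A.eval G l)

/-- The deterministic LOCAL complexity: the smallest `r` such that some local rule of radius `r`
(which may depend on `n`) solves `C` on all graphs of order `n` in the family for all choices of
identifiers; it is `⊤` if there is no such `r`. -/
noncomputable def detComplexity (C : LCL.{u}) (𝓗 : GraphFamily.{u}) (n : ℕ) : ℕ∞ :=
  sInf {k : ℕ∞ | ∃ r : ℕ, k = r ∧ ∃ A : LocalRule.{u} (Fin n) ℕ r, SolvesAll C 𝓗 n A}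

/-- A function with values in `ℕ ∪ {∞}` is `o(log n)` as `n → ∞`: it is finite for all large `n`,
and its values (read as real numbers) are `o(log n)`. -/
def IsLittleOLog (f : ℕ → ℕ∞) : Prop :=
  (∀ᶠ n in atTop, f n ≠ ⊤) ∧
    (fun n : ℕ => ((f n).toNat : ℝ)) =o[atTop] (fun n : ℕ => Real.log n)

/-- The graph `G` on the standard Borel space `V` is a Borel graph: its adjacency relation is a
Borel subset of `V × V`. -/
def IsBorelGraph {V : Type u} [MeasurableSpace V] [StandardBorelSpace V]
    (G : SimpleGraph V) : Prop :=
  MeasurableSet {p : V × V | G.Adj p.1 p.2}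

end LocalBorel

/-! A rule of radius `r` sees only an `r`-ball, so it cannot tell unique identifiers from a
colouring that is merely injective on balls. Let `t` be the radius of `C`, `r` the complexity at
`n`, and `s = t + r`. Since `r` is `o(log n)`, some `n` satisfies `(d + 1) ^ (2 * s) ≤ n`. Joining
distinct points at distance at most `2 * s` then gives a Borel graph with degrees below `n`, which
has a Borel proper `n`-colouring `c` (`exists_measurable_fin_coloring`); this `c` is injective on
`s`-balls.

Run the rule with `c` as identifiers. To check `C` at `x`, pad the `s`-ball with isolated vertices
to order `n` and extend `c` to a bijection. The rule is correct there, and neither the `t`-ball of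
`x` nor the outputs on it have changed (`SolvesAll.solves_of_injOn`).

The output is Borel because a coloured `r`-ball is determined by finitely many Borel bits
(`LocalRule.measurable_eval`). Quantifiers over balls preserve Borelness by
`measurableSet_exists_of_encard_le`, an application of Lusin–Souslin. -/

namespace LocalBorel

/-! ### Borel projections with small sections -/

open MeasureTheory

/-- The projection of a Borel set with vertical sections of bounded finite size is Borel. -/
theorem measurableSet_exists_of_encard_le {X Y : Type*} [MeasurableSpace X] [StandardBorelSpace X]
    [MeasurableSpace Y] [StandardBorelSpace Y] (k : ℕ) {P : Set (X × Y)} (hP : MeasurableSet P)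
    (hk : ∀ x, {y | (x, y) ∈ P}.encard ≤ k) : MeasurableSet {x | ∃ y, (x, y) ∈ P} := by
  induction k generalizing P with
  | zero =>
    have : {x | ∃ y, (x, y) ∈ P} = ∅ := by
      ext x
      have h := hk x
      simp only [Nat.cast_zero, nonpos_iff_eq_zero, Set.encard_eq_zero] at h
      simpa using fun y hy => (Set.ext_iff.1 h y).1 hy
    rw [this]
    exact MeasurableSet.empty
  | succ k ih =>
    have hf := measurableEmbedding_embeddingReal Y
    set f := embeddingReal Y
    let _ : LinearOrder Y := LinearOrder.lift' f hf.injective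
    have hlt : ∀ y z : Y, y < z ↔ f y < f z := fun y z => Iff.rfl
    -- Increasing enumerations of the sections of full size `k + 1`, in the order pulled back from
    -- the reals. Such an enumeration is unique, so the projection is injective on `S` and its image
    -- is Borel; the remaining sections have at most `k` points.
    let S : Set (X × (Fin (k + 1) → Y)) := {p | (∀ i, (p.1, p.2 i) ∈ P) ∧ StrictMono p.2}
    have hS : MeasurableSet S := by
      have : S = (⋂ i, {p | (p.1, p.2 i) ∈ P}) ∩
          ⋂ i, ⋂ j, ⋂ (_ : i < j), {p | f (p.2 i) < f (p.2 j)} := by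
        ext p
        simp only [S, StrictMono, hlt, Set.mem_inter_iff, Set.mem_iInter]
        rfl
      rw [this]
      refine (MeasurableSet.iInter fun i => ?_).inter
        (MeasurableSet.iInter fun i => MeasurableSet.iInter fun j => MeasurableSet.iInter fun _ => ?_)
      · exact measurableSet_preimage (f := fun p : X × (Fin (k + 1) → Y) => (p.1, p.2 i))
          (by fun_prop) hP
      · exact measurableSet_lt (hf.measurable.comp (by fun_prop)) (hf.measurable.comp (by fun_prop))
    have hfin : ∀ x, {y | (x, y) ∈ P}.Finite := fun x =>
      Set.finite_of_encard_le_coe (hk x)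
    have hinj : Set.InjOn Prod.fst S := by
      rintro ⟨x, y⟩ ⟨hy, hy'⟩ ⟨x', z⟩ ⟨hz, hz'⟩ (rfl : x = x')
      have key : ∀ w : Fin (k + 1) → Y, (∀ i, (x, w i) ∈ P) → StrictMono w →
          Set.range w = {y | (x, y) ∈ P} := by
        intro w hw hw'
        refine (Set.finite_range w).eq_of_subset_of_encard_le 
          (Set.range_subset_iff (s := {y | (x, y) ∈ P}).2 hw) ?_
        rw [← Set.image_univ, hw'.injective.encard_image]
        simpa [Set.encard_univ] using hk x
      have := (hy'.range_inj hz').1 ((key y hy hy').trans (key z hz hz').symm)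
      simp only [Prod.mk.injEq, true_and]
      exact this
    have hT : MeasurableSet (Prod.fst '' S) := hS.image_of_measurable_injOn measurable_fst hinj
    have hrest := ih (P := P \ Prod.fst ⁻¹' (Prod.fst '' S)) (hP.diff (measurable_fst hT)) ?_
    · convert hT.union hrest using 1
      ext x
      simp only [Set.mem_union]
      constructor
      · rintro ⟨y, hy⟩
        by_cases hx : x ∈ Prod.fst '' S
        · exact Or.inl hx
        · exact Or.inr ⟨y, hy, hx⟩
      · rintro (⟨p, hp, rfl⟩ | ⟨y, hy, -⟩)
        · exact ⟨p.2 0, hp.1 0⟩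
        · exact ⟨y, hy⟩
    · intro x
      by_cases hx : x ∈ Prod.fst '' S
      · have : {y | (x, y) ∈ P \ Prod.fst ⁻¹' (Prod.fst '' S)} = ∅ := by
          ext y
          exact ⟨fun hy => (hy.2 hx).elim, fun hy => hy.elim⟩
        rw [this, Set.encard_empty]
        exact zero_le
      · refine (Set.encard_le_encard (t := {y | (x, y) ∈ P}) fun y hy => hy.1).trans ?_
        by_contra! hlt'
        apply hx
        have hcard : (hfin x).toFinset.card = k + 1 := by
          have h1 := hk x
          rw [(hfin x).encard_eq_coe_toFinset_card] at h1 hlt'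
          have h1' : (hfin x).toFinset.card ≤ k + 1 := by exact_mod_cast h1
          have h2' : k < (hfin x).toFinset.card := by exact_mod_cast hlt'
          omega
        exact ⟨(x, (hfin x).toFinset.orderEmbOfFin hcard),
          ⟨fun i => (hfin x).mem_toFinset.1 (Finset.orderEmbOfFin_mem (hfin x).toFinset hcard i),
            OrderEmbedding.strictMono _⟩, rfl⟩

/-! ### Metric balls in graphs -/

theorem mem_closedBall_succ {V : Type u} {G : SimpleGraph V} {x y : V} {k : ℕ} :
    y ∈ closedBall G x (k + 1) ↔ ∃ w ∈ closedBall G x k, w = y ∨ G.Adj w y := by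
  constructor
  · intro h
    -- The walk is taken from `y` to `x`, so that its `cons` case strips the edge at `y`.
    have h' : G.edist y x ≤ (k + 1 : ℕ) := by rw [SimpleGraph.edist_comm]; exact h
    obtain ⟨p, hp⟩ := SimpleGraph.exists_walk_of_edist_ne_top (ne_top_of_le_ne_top (by simp) h')
    rw [← hp] at h'
    cases p with
    | nil => exact ⟨_, center_mem G _ k, Or.inl rfl⟩
    | cons hadj p =>
      rename_i w
      refine ⟨w, ?_, Or.inr hadj.symm⟩
      have hl : p.length ≤ k := by
        have : p.length + 1 ≤ k + 1 := by exact_mod_cast h'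
        omega
      change G.edist x w ≤ k
      rw [SimpleGraph.edist_comm]
      exact p.edist_le.trans (by exact_mod_cast hl)
  · rintro ⟨w, hw, h⟩
    have h1 : G.edist w y ≤ 1 := SimpleGraph.edist_le_one_iff_adj_or_eq.2 h.symm
    change G.edist x y ≤ (k + 1 : ℕ)
    push_cast
    exact SimpleGraph.edist_triangle.trans (add_le_add hw h1)

theorem mem_closedBall_zero {V : Type u} {G : SimpleGraph V} {x y : V} :
    y ∈ closedBall G x 0 ↔ x = y := by
  change G.edist x y ≤ (0 : ℕ) ↔ x = y
  rw [Nat.cast_zero, nonpos_iff_eq_zero, SimpleGraph.edist_eq_zero_iff]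

theorem mem_closedBall_comm {V : Type u} {G : SimpleGraph V} {x y : V} {k : ℕ} :
    y ∈ closedBall G x k ↔ x ∈ closedBall G y k := by
  change G.edist x y ≤ k ↔ G.edist y x ≤ k
  rw [SimpleGraph.edist_comm]

theorem mem_closedBall_add {V : Type u} {G : SimpleGraph V} {x y z : V} {j k : ℕ}
    (hy : y ∈ closedBall G x j) (hz : z ∈ closedBall G y k) : z ∈ closedBall G x (j + k) := by
  change G.edist x z ≤ (j + k : ℕ)
  push_cast
  exact SimpleGraph.edist_triangle.trans (add_le_add hy hz)

theorem closedBall_mono {V : Type u} (G : SimpleGraph V) (x : V) {j k : ℕ} (h : j ≤ k) :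
    closedBall G x j ⊆ closedBall G x k := fun y hy =>
  le_trans (show G.edist x y ≤ j from hy) (by exact_mod_cast h)

theorem encard_closedBall_le {V : Type u} {G : SimpleGraph V} {d : ℕ}
    (hd : ∀ x, (G.neighborSet x).encard ≤ d) (x : V) (k : ℕ) :
    (closedBall G x k).encard ≤ ((d + 1) ^ k : ℕ) := by
  induction k with
  | zero =>
    have : closedBall G x 0 = {x} := by
      ext y
      rw [mem_closedBall_zero, Set.mem_singleton_iff, eq_comm]
    simp [this]
  | succ k ih =>
    have hfin : (closedBall G x k).Finite := Set.finite_of_encard_le_coe ih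
    have hcover : closedBall G x (k + 1) =
        ⋃ w ∈ hfin.toFinset, insert w (G.neighborSet w) := by
      ext y
      rw [mem_closedBall_succ]
      simp [eq_comm (a := y)]
    rw [hcover]
    calc _ ≤ ∑ w ∈ hfin.toFinset, (insert w (G.neighborSet w)).encard :=
          Finset.set_encard_biUnion_le _ _
      _ ≤ ∑ _w ∈ hfin.toFinset, ((d + 1 : ℕ) : ℕ∞) := by
          refine Finset.sum_le_sum fun w _ => (Set.encard_insert_le _ _).trans ?_
          push_cast
          exact add_le_add (hd w) le_rfl
      _ = (hfin.toFinset.card * (d + 1) : ℕ) := by simp [mul_add]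
      _ ≤ ((d + 1) ^ (k + 1) : ℕ) := by
          rw [hfin.encard_eq_coe_toFinset_card] at ih
          rw [pow_succ]
          exact_mod_cast Nat.mul_le_mul_right _ (by exact_mod_cast ih)

/-! ### Borel colourings of bounded degree graphs -/

section Borel

variable {V : Type u} [MeasurableSpace V] [StandardBorelSpace V] {G : SimpleGraph V}

/-- The quantifier over the penultimate vertex of a path ranges over a `k`-ball, which has at most
`(d + 1) ^ k` points. -/
theorem measurableSet_closedBall {d : ℕ} (hG : IsBorelGraph G)
    (hd : ∀ x, (G.neighborSet x).encard ≤ d) (k : ℕ) :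
    MeasurableSet {p : V × V | p.2 ∈ closedBall G p.1 k} := by
  induction k with
  | zero =>
    simp only [mem_closedBall_zero]
    exact measurableSet_eq_fun measurable_fst measurable_snd
  | succ k ih =>
    let P : Set ((V × V) × V) :=
      {q | q.2 ∈ closedBall G q.1.1 k ∧ (q.2 = q.1.2 ∨ G.Adj q.2 q.1.2)}
    have hP : MeasurableSet P := by
      refine MeasurableSet.inter ?_ (MeasurableSet.union ?_ ?_)
      · exact measurableSet_preimage (f := fun q : (V × V) × V => (q.1.1, q.2)) (by fun_prop) ih
      · exact measurableSet_eq_fun (by fun_prop) (by fun_prop)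
      · exact measurableSet_preimage (f := fun q : (V × V) × V => (q.2, q.1.2)) (by fun_prop) hG
    convert measurableSet_exists_of_encard_le ((d + 1) ^ k) hP ?_ using 1
    · ext p
      exact mem_closedBall_succ
    · exact fun p => (Set.encard_le_encard fun y hy => hy.1).trans (encard_closedBall_le hd p.1 k)

theorem exists_lt_forall_ne_of_encard_lt {α : Type*} {s : Set α} {n : ℕ} (hs : s.encard < n)
    (g : α → ℕ) : ∃ j < n, ∀ y ∈ s, g y ≠ j := by
  by_contra! h
  have hsub : (Finset.range n : Set ℕ) ⊆ g '' s := fun j hj => h j (by simpa using hj)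
  have := (Set.encard_le_encard hsub).trans (Set.encard_image_le g s)
  rw [Set.encard_coe_eq_coe_finsetCard, Finset.card_range] at this
  exact absurd this (not_le.2 hs)

theorem measurableSet_exists_adj {n : ℕ} (hG : IsBorelGraph G)
    (hn : ∀ x, (G.neighborSet x).encard < n) {B : Set V} (hB : MeasurableSet B) :
    MeasurableSet {x | ∃ y, G.Adj x y ∧ y ∈ B} :=
  measurableSet_exists_of_encard_le n (P := {p | G.Adj p.1 p.2 ∧ p.2 ∈ B})
    (MeasurableSet.inter hG (measurable_snd hB))
    fun x => (Set.encard_le_encard fun _ hy => hy.1).trans (hn x).le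

theorem measurable_sInf_nat {α : Type*} [MeasurableSpace α] {p : α → ℕ → Prop}
    (hp : ∀ x, ∃ j, p x j) (hm : ∀ j, MeasurableSet {x | p x j}) :
    Measurable fun x => sInf {j | p x j} := by
  classical
  have : (fun x => sInf {j | p x j}) = fun x => Nat.find (hp x) := by
    funext x
    exact Nat.sInf_def (hp x)
  rw [this]
  exact measurable_find hp hm

/-- A Borel graph of bounded degree has a Borel proper colouring with countably many colours. -/
theorem exists_measurable_nat_coloring {n : ℕ} (hG : IsBorelGraph G)
    (hn : ∀ x, (G.neighborSet x).encard < n) :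
    ∃ c : V → ℕ, Measurable c ∧ ∀ x y, G.Adj x y → c x ≠ c y := by
  have hf := measurableEmbedding_embeddingReal V
  set f := embeddingReal V
  have hbasis := TopologicalSpace.isBasis_countableBasis ℝ
  obtain ⟨b, hb⟩ := (TopologicalSpace.countable_countableBasis ℝ).exists_eq_range
    ((hbasis.exists_subset_of_mem_open (Set.mem_univ 0) isOpen_univ).imp fun _ h => h.1)
  have hopen : ∀ i, IsOpen (b i) := fun i =>
    hbasis.isOpen (by rw [hb]; exact Set.mem_range_self i)
  -- A basic open set separating `x` from its finitely many neighbours. Adjacent vertices cannot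
  -- share an index, so the least index is a proper colour.
  let p : V → ℕ → Prop := fun x i => f x ∈ b i ∧ ¬ ∃ y, G.Adj x y ∧ y ∈ f ⁻¹' b i
  have hp : ∀ x, ∃ i, p x i := by
    intro x
    have hfin : (G.neighborSet x).Finite := Set.finite_of_encard_le_coe (hn x).le
    have ho : IsOpen (f '' G.neighborSet x)ᶜ := (hfin.image f).isClosed.isOpen_compl
    have hx : f x ∈ (f '' G.neighborSet x)ᶜ := by
      rintro ⟨y, hy, hxy⟩
      exact (G.ne_of_adj hy) (hf.injective hxy).symm
    obtain ⟨s, hs, hxs, hsub⟩ := hbasis.exists_subset_of_mem_open hx ho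
    rw [hb] at hs
    obtain ⟨i, rfl⟩ := hs
    exact ⟨i, hxs, fun ⟨y, hy, hyb⟩ => hsub hyb ⟨y, hy, rfl⟩⟩
  have hm : ∀ i, MeasurableSet {x | p x i} := fun i =>
    (hf.measurable (hopen i).measurableSet).inter
      (measurableSet_exists_adj hG hn (hf.measurable (hopen i).measurableSet)).compl
  refine ⟨fun x => sInf {i | p x i}, measurable_sInf_nat hp hm, fun x y hxy h => ?_⟩
  have hx : p x (sInf {i | p x i}) := Nat.sInf_mem (hp x)
  have hy : p y (sInf {i | p y i}) := Nat.sInf_mem (hp y)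
  simp only at h
  rw [← h] at hy
  exact hx.2 ⟨y, hxy, hy.1⟩

/-- The greedy colouring along the classes of a colouring `c`, after the first `i` classes have
been treated: a vertex of the `i`-th class gets the least colour that no neighbour in an earlier
class has. -/
noncomputable def greedyColoring {V : Type*} (G : SimpleGraph V) (c : V → ℕ) : ℕ → V → ℕ
  | 0, _ => 0
  | i + 1, x =>
    if c x = i then sInf {j | ∀ y, G.Adj x y → c y < i → greedyColoring G c i y ≠ j}
    else greedyColoring G c i x

theorem greedyColoring_eq {V : Type*} (G : SimpleGraph V) (c : V → ℕ) {i : ℕ} {x : V}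
    (h : c x < i) : greedyColoring G c i x = greedyColoring G c (c x + 1) x := by
  induction i with
  | zero => omega
  | succ i ih =>
    rcases Nat.lt_succ_iff_lt_or_eq.1 h with h' | h'
    · rw [greedyColoring, if_neg h'.ne, ih h']
    · rw [h']

/-- A Borel graph whose degrees are smaller than `n` has a Borel proper colouring with `n`
colours. -/
theorem exists_measurable_fin_coloring {n : ℕ} (hG : IsBorelGraph G)
    (hn : ∀ x, (G.neighborSet x).encard < n) :
    ∃ c : V → Fin n, Measurable c ∧ ∀ x y, G.Adj x y → c x ≠ c y := by
  obtain ⟨c, hc, hproper⟩ := exists_measurable_nat_coloring hG hn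
  have hex : ∀ i x, ∃ j < n, ∀ y, G.Adj x y → c y < i → greedyColoring G c i y ≠ j := by
    intro i x
    obtain ⟨j, hj, h⟩ := exists_lt_forall_ne_of_encard_lt (hn x) (greedyColoring G c i)
    exact ⟨j, hj, fun y hy _ => h y hy⟩
  have hmeas : ∀ i, Measurable (greedyColoring G c i) := by
    intro i
    induction i with
    | zero => exact measurable_const
    | succ i ih =>
      refine Measurable.ite (hc (measurableSet_singleton i)) (measurable_sInf_nat
        (fun x => (hex i x).imp fun _ h => h.2) fun j => ?_) ih
      have := (measurableSet_exists_adj hG hn (B := {y | c y < i} ∩ greedyColoring G c i ⁻¹' {j})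
        ((measurableSet_lt hc measurable_const).inter (ih (measurableSet_singleton j)))).compl
      convert this using 1
      ext x
      simp only [Set.mem_compl_iff]
      change _ ↔ ¬ ∃ y, G.Adj x y ∧ (c y < i ∧ greedyColoring G c i y = j)
      push Not
      rfl
  let g : V → ℕ := fun x => greedyColoring G c (c x + 1) x
  have hg : Measurable g := by
    have : Measurable fun p : ℕ × V => greedyColoring G c p.1 p.2 :=
      measurable_from_prod_countable_right hmeas
    exact this.comp ((hc.add_const 1).prodMk measurable_id)
  -- Neighbours in earlier classes already carry their final colour when `x` is treated, so the
  -- stages drop out of the recursion.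
  have hgeq : ∀ x, g x = sInf {j | ∀ y, G.Adj x y → c y < c x → g y ≠ j} := by
    intro x
    simp only [g]
    rw [greedyColoring, if_pos rfl]
    congr 1
    ext j
    refine forall₃_congr fun y _ hlt => ?_
    rw [greedyColoring_eq G c hlt]
  have hgex : ∀ x, ∃ j < n, ∀ y, G.Adj x y → c y < c x → g y ≠ j := by
    intro x
    obtain ⟨j, hj, h⟩ := exists_lt_forall_ne_of_encard_lt (hn x) g
    exact ⟨j, hj, fun y hy _ => h y hy⟩
  have hgn : ∀ x, g x < n := by
    intro x
    obtain ⟨j, hj, h⟩ := hgex x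
    rw [hgeq]
    exact (Nat.sInf_le (Set.mem_ofPred.2 h)).trans_lt hj
  have hearlier : ∀ x y, G.Adj x y → c y < c x → g y ≠ g x := by
    intro x
    have : sInf {j | ∀ y, G.Adj x y → c y < c x → g y ≠ j} ∈
        {j | ∀ y, G.Adj x y → c y < c x → g y ≠ j} := Nat.sInf_mem ((hgex x).imp fun _ h => h.2)
    rw [← hgeq] at this
    exact this
  refine ⟨fun x => ⟨g x, hgn x⟩, ?_, fun x y hxy h => ?_⟩
  · refine measurable_to_countable' fun i => ?_
    convert hg (measurableSet_singleton (i : ℕ)) using 1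
    ext x
    simp [Fin.ext_iff]
  · have h' : g x = g y := congrArg Fin.val h
    rcases lt_or_gt_of_ne (hproper x y hxy) with hlt | hlt
    · exact hearlier y x hxy.symm hlt h'
    · exact hearlier x y hxy hlt h'.symm

end Borel

end LocalBorel

/-! ### Local rules run on ball-injective colourings -/

namespace LocalBorel

theorem sameBall_of_range_eq {L : Type*} {V W : Type u} {r : ℕ} {G : SimpleGraph V} {l : V → L}
    {x : V} {H : SimpleGraph W} {m : W → L} {y : W} (f : closedBall G x r → W)
    (hinj : Function.Injective f) (hrange : Set.range f = closedBall H y r)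
    (hadj : ∀ u v, H.Adj (f u) (f v) ↔ G.Adj u v) (hroot : f ⟨x, center_mem G x r⟩ = y)
    (hlab : ∀ v, m (f v) = l v) : SameBall r G l x H m y := by
  have hmem : ∀ v, f v ∈ closedBall H y r := fun v => by
    rw [← hrange]
    exact Set.mem_range_self v
  let g : closedBall G x r → closedBall H y r := fun v => ⟨f v, hmem v⟩
  have hg : Function.Bijective g := by
    refine ⟨fun u v h => hinj (congrArg Subtype.val h), fun z => ?_⟩
    obtain ⟨v, hv⟩ : (z : W) ∈ Set.range f := by
      rw [hrange]
      exact z.2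
    exact ⟨v, Subtype.ext hv⟩
  exact ⟨⟨Equiv.ofBijective g hg, hadj _ _⟩, Subtype.ext hroot, hlab⟩

/-- If the colouring `c` is injective on `r`-balls, then the `r`-ball around a vertex, with the
labels given by `c`, is determined by the colour of the vertex, the colours that occur in the
ball, and the pairs of colours of adjacent vertices of the ball. -/
theorem sameBall_of_colors {L : Type*} {V : Type u} {r : ℕ} {G : SimpleGraph V} {c : V → L}
    (hc : ∀ x, Set.InjOn c (closedBall G x r)) {x x' : V} (hroot : c x = c x')
    (hvert : ∀ i, (∃ y ∈ closedBall G x r, c y = i) ↔ ∃ y ∈ closedBall G x' r, c y = i)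
    (hedge : ∀ i j,
      (∃ y ∈ closedBall G x r, c y = i ∧ ∃ z ∈ closedBall G x r, G.Adj y z ∧ c z = j) ↔
      ∃ y ∈ closedBall G x' r, c y = i ∧ ∃ z ∈ closedBall G x' r, G.Adj y z ∧ c z = j) :
    SameBall r G c x G c x' := by
  have h : ∀ y : closedBall G x r, ∃ y' ∈ closedBall G x' r, c y' = c y := fun y =>
    (hvert (c y)).1 ⟨y, y.2, rfl⟩
  choose f hf hfc using h
  refine sameBall_of_range_eq f (fun u v huv => Subtype.ext (hc x u.2 v.2 ?_)) ?_ ?_ ?_ hfc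
  · rw [← hfc, ← hfc, huv]
  · refine Set.Subset.antisymm (Set.range_subset_iff.2 hf) fun z hz => ?_
    obtain ⟨y, hy, hyz⟩ := (hvert (c z)).2 ⟨z, hz, rfl⟩
    exact ⟨⟨y, hy⟩, hc x' (hf _) hz ((hfc _).trans hyz)⟩
  · intro u v
    constructor
    · intro huv
      obtain ⟨y, hy, hyu, z, hz, hyz, hzv⟩ := (hedge (c u) (c v)).2
        ⟨f u, hf u, hfc u, f v, hf v, huv, hfc v⟩
      rwa [hc x hy u.2 hyu, hc x hz v.2 hzv] at hyz
    · intro huv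
      obtain ⟨y, hy, hyu, z, hz, hyz, hzv⟩ := (hedge (c u) (c v)).1
        ⟨u, u.2, rfl, v, v.2, huv, rfl⟩
      rwa [hc x' hy (hf u) (hyu.trans (hfc u).symm), hc x' hz (hf v) (hzv.trans (hfc v).symm)]
        at hyz
  · exact hc x' (hf _) (center_mem G x' r) ((hfc _).trans hroot)

/-- A local rule run on a bounded degree Borel graph with a finite Borel colouring that is
injective on balls gives a Borel function. -/
theorem LocalRule.measurable_eval {V : Type u} [MeasurableSpace V] [StandardBorelSpace V]
    {G : SimpleGraph V} {d n r : ℕ} (hG : IsBorelGraph G)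
    (hd : ∀ x, (G.neighborSet x).encard ≤ d) (A : LocalRule.{u} (Fin n) ℕ r) {c : V → Fin n}
    (hcm : Measurable c) (hc : ∀ x, Set.InjOn c (closedBall G x r)) :
    Measurable (A.eval G c) := by
  have hB := measurableSet_closedBall hG hd r
  have hproj : ∀ {P : V × V → Prop}, Measurable P →
      Measurable fun x => ∃ y ∈ closedBall G x r, P (x, y) := fun {P} hP =>
    measurableSet_setOfPred.1 <| measurableSet_exists_of_encard_le ((d + 1) ^ r)
      (P := {p | p.2 ∈ closedBall G p.1 r ∧ P p}) (hB.inter hP.setOf)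
      fun x => (Set.encard_le_encard fun _ hy => hy.1).trans (encard_closedBall_le hd x r)
  have hcolor : ∀ i, Measurable fun x => c x = i := fun i =>
    measurableSet_setOfPred.1 (hcm (measurableSet_singleton i))
  have hproj₂ : ∀ j, Measurable fun p : V × V =>
      ∃ z ∈ closedBall G p.1 r, G.Adj p.2 z ∧ c z = j := by
    intro j
    refine measurableSet_setOfPred.1 <| measurableSet_exists_of_encard_le ((d + 1) ^ r)
      (P := {q : (V × V) × V | q.2 ∈ closedBall G q.1.1 r ∧ G.Adj q.1.2 q.2 ∧ c q.2 = j}) ?_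
      fun p => (Set.encard_le_encard fun _ hy => hy.1).trans (encard_closedBall_le hd p.1 r)
    refine MeasurableSet.inter ?_ (MeasurableSet.inter ?_ ?_)
    · exact measurableSet_preimage (f := fun q : (V × V) × V => (q.1.1, q.2)) (by fun_prop) hB
    · exact measurableSet_preimage (f := fun q : (V × V) × V => (q.1.2, q.2)) (by fun_prop) hG
    · exact measurable_snd (hcolor j).setOf
  -- The target is finite, so every function that factors through this Borel map is Borel.
  let code : V → Fin n × (Fin n → Prop) × (Fin n → Fin n → Prop) := fun x =>
    (c x, fun i => ∃ y ∈ closedBall G x r, c y = i, fun i j =>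
      ∃ y ∈ closedBall G x r, c y = i ∧ ∃ z ∈ closedBall G x r, G.Adj y z ∧ c z = j)
  have hcode : Measurable code := by
    refine hcm.prodMk (Measurable.prodMk ?_ ?_)
    · exact measurable_pi_iff.2 fun i =>
        hproj (P := fun p => c p.2 = i) ((hcolor i).comp measurable_snd)
    · exact measurable_pi_iff.2 fun i => measurable_pi_iff.2 fun j =>
        hproj (P := fun p => c p.2 = i ∧ ∃ z ∈ closedBall G p.1 r, G.Adj p.2 z ∧ c z = j)
          (((hcolor i).comp measurable_snd).and (hproj₂ j))
  have hfactor : Function.FactorsThrough (A.eval G c) code := by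
    intro x x' h
    simp only [code, Prod.mk.injEq, funext_iff, eq_iff_iff] at h
    exact A.eval_eq G c x G c x' (sameBall_of_colors hc h.1 h.2.1 h.2.2)
  intro B _
  have hpre : A.eval G c ⁻¹' B = code ⁻¹' (code '' (A.eval G c ⁻¹' B)) := by
    refine Set.Subset.antisymm (Set.subset_preimage_image _ _) ?_
    rintro x ⟨x', hx', h⟩
    rw [Set.mem_preimage, ← hfactor h]
    exact hx'
  rw [hpre]
  exact hcode (Set.toFinite _).measurableSet

/-! ### Padding a ball to a prescribed order -/

theorem exists_card_eq_add {𝓗 : GraphFamily.{u}} (hisol : ClosedUnderIsolated 𝓗) {B : Type u}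
    [Finite B] {K : SimpleGraph B} (hK : 𝓗 K) (m : ℕ) :
    ∃ (W : Type u) (H : SimpleGraph W) (e : B → W), 𝓗 H ∧ Finite W ∧
      Nat.card W = Nat.card B + m ∧ Function.Injective e ∧
      (∀ u v, H.Adj (e u) (e v) ↔ K.Adj u v) ∧ ∀ v w, H.Adj (e v) w → w ∈ Set.range e := by
  induction m with
  | zero => exact ⟨B, K, id, hK, inferInstance, rfl, Function.injective_id, fun _ _ => Iff.rfl,
      fun _ w _ => ⟨w, rfl⟩⟩
  | succ m ih =>
    obtain ⟨W, H, e, hH, hfin, hcard, hinj, hadj, hcl⟩ := ih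
    refine ⟨W ⊕ PUnit.{u + 1}, H ⊕g ⊥, Sum.inl ∘ e, hisol H hH, inferInstance, ?_,
      Sum.inl_injective.comp hinj, fun u v => ?_, fun v w hw => ?_⟩
    · rw [Nat.card_sum, hcard]
      simp [add_assoc]
    · simpa using hadj u v
    · rcases w with w | w
      · obtain ⟨b, rfl⟩ := hcl v w (by simpa using hw)
        exact ⟨b, rfl⟩
      · simp at hw

section Embedding

variable {V W : Type u} {G : SimpleGraph V} {x : V} {s : ℕ} {H : SimpleGraph W}
  {e : closedBall G x s → W}

/-- Walks in `H` cannot leave the image of `e`, and `j + k ≤ s` keeps the relevant walks of `G`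
inside the `s`-ball, so the two kinds of walk correspond edge by edge. -/
theorem mem_closedBall_iff_of_embedding (hadj : ∀ u v, H.Adj (e u) (e v) ↔ G.Adj u v)
    (hcl : ∀ v w, H.Adj (e v) w → w ∈ Set.range e) {j k : ℕ} (hjk : j + k ≤ s)
    {y : closedBall G x s} (hy : (y : V) ∈ closedBall G x j) {z : W} :
    z ∈ closedBall H (e y) k ↔ ∃ v : closedBall G x s, (v : V) ∈ closedBall G y k ∧ e v = z := by
  induction k generalizing z with
  | zero =>
    rw [mem_closedBall_zero]
    simp only [mem_closedBall_zero]
    constructor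
    · rintro rfl
      exact ⟨y, rfl, rfl⟩
    · rintro ⟨v, hv, rfl⟩
      rw [Subtype.ext hv]
  | succ k ih =>
    have ih' := fun w => ih (z := w) (by omega)
    rw [mem_closedBall_succ]
    constructor
    · rintro ⟨w, hw, hwz⟩
      obtain ⟨v, hv, rfl⟩ := (ih' w).1 hw
      rcases hwz with rfl | hvz
      · exact ⟨v, closedBall_mono G y (Nat.le_succ k) hv, rfl⟩
      · obtain ⟨u, rfl⟩ := hcl v z hvz
        exact ⟨u, mem_closedBall_succ.2 ⟨v, hv, Or.inr ((hadj v u).1 hvz)⟩, rfl⟩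
    · rintro ⟨v, hv, rfl⟩
      obtain ⟨w, hw, hwv⟩ := mem_closedBall_succ.1 hv
      have hws : w ∈ closedBall G x s :=
        closedBall_mono G x (by omega) (mem_closedBall_add hy hw)
      refine ⟨e ⟨w, hws⟩, (ih' _).2 ⟨⟨w, hws⟩, hw, rfl⟩, ?_⟩
      rcases hwv with h | h
      · exact Or.inl (congrArg e (Subtype.ext h))
      · exact Or.inr ((hadj ⟨w, hws⟩ v).2 h)

/-- If the `s`-ball around `x` is embedded as a union of components in another graph, the smaller
balls inside it keep their isomorphism type. -/
theorem sameBall_of_embedding {L : Type*} (hadj : ∀ u v, H.Adj (e u) (e v) ↔ G.Adj u v)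
    (hcl : ∀ v w, H.Adj (e v) w → w ∈ Set.range e) (hinj : Function.Injective e)
    {j r : ℕ} (hjr : j + r ≤ s)
    {y : closedBall G x s} (hy : (y : V) ∈ closedBall G x j) {l : V → L} {m : W → L}
    (hl : ∀ v : closedBall G x s, (v : V) ∈ closedBall G y r → m (e v) = l v) :
    SameBall r G l y H m (e y) := by
  have hsub : ∀ v ∈ closedBall G (y : V) r, v ∈ closedBall G x s := fun v hv =>
    closedBall_mono G x hjr (mem_closedBall_add hy hv)
  refine sameBall_of_range_eq (fun v => e ⟨v, hsub v v.2⟩) (fun u v h => ?_) ?_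
    (fun u v => hadj _ _) rfl fun v => hl _ v.2
  · exact Subtype.ext (congrArg (fun w : closedBall G x s => (w : V)) (hinj h))
  · ext z
    rw [mem_closedBall_iff_of_embedding hadj hcl hjr hy]
    constructor
    · rintro ⟨v, rfl⟩
      exact ⟨_, v.2, rfl⟩
    · rintro ⟨v, hv, rfl⟩
      exact ⟨⟨v, hv⟩, rfl⟩

end Embedding

/-! ### From identifiers to colourings -/

theorem exists_solvesAll_of_detComplexity_ne_top {C : LCL.{u}} {𝓗 : GraphFamily.{u}} {n : ℕ}
    (h : detComplexity C 𝓗 n ≠ ⊤) :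
    ∃ A : LocalRule.{u} (Fin n) ℕ (detComplexity C 𝓗 n).toNat, SolvesAll C 𝓗 n A := by
  have hne : {k : ℕ∞ | ∃ r : ℕ, k = r ∧ ∃ A : LocalRule.{u} (Fin n) ℕ r,
      SolvesAll C 𝓗 n A}.Nonempty := by
    by_contra hemp
    rw [Set.not_nonempty_iff_eq_empty] at hemp
    exact h (by rw [detComplexity, hemp, sInf_empty])
  obtain ⟨r, hr, A, hA⟩ := csInf_mem hne
  have : (detComplexity C 𝓗 n).toNat = r := by
    rw [detComplexity, hr, ENat.toNat_natCast]
  rw [this]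
  exact ⟨A, hA⟩

/-- A function that is `o(log n)` is eventually so small that balls of twice its radius (plus a
constant) in a graph of bounded degree have at most `n` vertices. -/
theorem eventually_pow_le_of_isLittleO_log {f : ℕ → ℕ}
    (hf : (fun n => (f n : ℝ)) =o[atTop] fun n : ℕ => Real.log n) (b t : ℕ) (hb : 0 < b) :
    ∀ᶠ n in atTop, b ^ (2 * (t + f n)) ≤ n := by
  have hL : 0 ≤ Real.log b := Real.log_natCast_nonneg b
  have hlog : Tendsto (fun n : ℕ => Real.log n) atTop atTop :=
    Real.tendsto_log_atTop.comp tendsto_natCast_atTop_atTop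
  -- The two bounds make `2 * f n * log b` and `2 * t * log b` each at most half of `log n`; the `+
  -- 1` avoids division by zero when `b = 1`.
  filter_upwards [hf.def (c := 1 / (4 * (Real.log b + 1))) (by positivity),
    hlog.eventually_ge_atTop (4 * t * Real.log b), eventually_gt_atTop 0] with n h1 h2 hn
  have hlogn : 0 ≤ Real.log n := Real.log_natCast_nonneg n
  rw [Real.norm_of_nonneg (by positivity), Real.norm_of_nonneg hlogn, div_mul_eq_mul_div, one_mul,
    le_div_iff₀ (by positivity)] at h1
  have hfn : (0 : ℝ) ≤ f n := Nat.cast_nonneg _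
  have hb' : (0 : ℝ) < b := by exact_mod_cast hb
  have hn' : (0 : ℝ) < n := by exact_mod_cast hn
  have key : Real.log ((b : ℝ) ^ (2 * (t + f n))) ≤ Real.log n := by
    rw [Real.log_pow]
    push_cast
    nlinarith
  have := (Real.log_le_log_iff (by positivity) hn').1 key
  exact_mod_cast this

/-- If a rule solves `C` on all graphs of order `n` in `𝓗`, then it also solves `C` with the
identifiers replaced by a colouring that is injective on balls. -/
theorem SolvesAll.solves_of_injOn {𝓗 : GraphFamily.{u}} (hisol : ClosedUnderIsolated 𝓗)
    {C : LCL.{u}} {n r : ℕ} {A : LocalRule.{u} (Fin n) ℕ r} (hA : SolvesAll C 𝓗 n A) {V : Type u}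
    {G : SimpleGraph V} (hball : ∀ x, 𝓗 (ballGraph G x (C.radius + r))) {c : V → Fin n}
    (hc : ∀ x, Set.InjOn c (closedBall G x (C.radius + r))) : C.Solves G (A.eval G c) := by
  intro x
  set s := C.radius + r
  have hcinj : Function.Injective fun v : closedBall G x s => c v := (hc x).injective
  have hfin : Finite (closedBall G x s) := Finite.of_injective _ hcinj
  have hcard : Nat.card (closedBall G x s) ≤ n := by
    simpa using Nat.card_le_card_of_injective _ hcinj
  obtain ⟨W, H, e, hH, hW, hWcard, hinj, hadj, hcl⟩ :=
    exists_card_eq_add hisol (hball x) (n - Nat.card (closedBall G x s))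
  rw [Nat.add_sub_cancel' hcard] at hWcard
  obtain ⟨ℓ, hℓ⟩ : ∃ ℓ : W ≃ Fin n, ∀ v, ℓ (e v) = c v := by
    have := Fintype.ofFinite W
    -- The default `c x` is irrelevant: only the values on the range of `e` are kept in the
    -- bijection.
    let g : W → Fin n := Function.extend e (fun v => c v) fun _ => c x
    have hg : ∀ v, g (e v) = c v := fun v => hinj.extend_apply _ _ v
    obtain ⟨ℓ, hℓ⟩ := Set.MapsTo.exists_equiv_extend_of_card_eq (t := Finset.univ)
      (s := Set.range e) (f := g)
      (by rw [← Nat.card_eq_fintype_card, hWcard, Finset.card_univ, Fintype.card_fin])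
      (fun _ _ => by simp) (by
        rintro _ ⟨u, rfl⟩ _ ⟨v, rfl⟩ h
        rw [hg, hg] at h
        exact congrArg e (hcinj h))
    exact ⟨ℓ.trans (Equiv.subtypeUnivEquiv fun _ => Finset.mem_univ _), fun v =>
      (hℓ _ ⟨v, rfl⟩).trans (hg v)⟩
  have hbase := center_mem G x s
  -- Within distance `C.radius` of `x`, the whole `r`-ball still fits in the `s`-ball, so the rule
  -- sees the same picture in `H` as in `G`.
  have hlocal : ∀ v : closedBall G x s, (v : V) ∈ closedBall G x C.radius →
      A.eval H ℓ (e v) = A.eval G c v := fun v hv =>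
    (A.eval_eq _ _ _ _ _ _ (sameBall_of_embedding hadj hcl hinj le_rfl hv fun u _ => hℓ u)).symm
  rw [C.rule.eval_eq _ _ _ _ _ _ (sameBall_of_embedding hadj hcl hinj (j := 0)
    (by omega) (y := ⟨x, hbase⟩) (center_mem G x 0) hlocal)]
  exact hA H ℓ hH _

end LocalBorel

/-! ### The theorem -/

open LocalBorel in
theorem theorem10p1 (𝓗 : LocalBorel.GraphFamily.{u}) (d : ℕ)
    (hdeg : LocalBorel.DegreesBounded 𝓗 d)
    (hisol : LocalBorel.ClosedUnderIsolated 𝓗)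
    (C : LocalBorel.LCL.{u})
    (hC : LocalBorel.IsLittleOLog (LocalBorel.detComplexity C 𝓗))
    {V : Type u} [MeasurableSpace V] [StandardBorelSpace V] (G : SimpleGraph V)
    (hG : LocalBorel.IsBorelGraph G)
    (hball : ∀ (x : V) (r : ℕ), 𝓗 (LocalBorel.ballGraph G x r)) :
    ∃ a : V → ℕ, Measurable a ∧ C.Solves G a := by
  have hd : ∀ x, (G.neighborSet x).encard ≤ d := by
    intro x
    have hsub : G.neighborSet x ⊆
        (↑) '' ((ballGraph G x 1).neighborSet ⟨x, center_mem G x 1⟩) := fun y hy =>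
      ⟨⟨y, SimpleGraph.edist_le_one_iff_adj_or_eq.2 (Or.inl hy)⟩, hy, rfl⟩
    exact (Set.encard_le_encard hsub).trans ((Set.encard_image_le _ _).trans
      (hdeg _ (hball x 1) _))
  obtain ⟨n, hn, hfinite⟩ := ((eventually_pow_le_of_isLittleO_log hC.2 (d + 1) C.radius
    d.succ_pos).and hC.1).exists
  set r := (detComplexity C 𝓗 n).toNat
  obtain ⟨A, hA⟩ : ∃ A : LocalRule.{u} (Fin n) ℕ r, SolvesAll C 𝓗 n A :=
    exists_solvesAll_of_detComplexity_ne_top hfinite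
  set s := C.radius + r
  -- Two points of a common `s`-ball are at distance at most `2 * s`, so a proper colouring of `F`
  -- is injective on `s`-balls.
  let F : SimpleGraph V :=
    { Adj := fun x y => y ∈ closedBall G x (2 * s) ∧ x ≠ y
      symm := ⟨fun x y h => ⟨mem_closedBall_comm.1 h.1, h.2.symm⟩⟩
      loopless := ⟨fun x h => h.2 rfl⟩ }
  have hF : IsBorelGraph F := (measurableSet_closedBall hG hd (2 * s)).inter
    (measurableSet_eq_fun measurable_fst measurable_snd).compl
  have hFdeg : ∀ x, (F.neighborSet x).encard < n := by
    intro x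
    have hfin := Set.finite_of_encard_le_coe (encard_closedBall_le hd x (2 * s))
    -- The ball contains `x` itself, which is not its own neighbour; this gives the strict
    -- inequality needed to colour with exactly `n` colours.
    refine (hfin.subset fun y hy => hy.1).encard_lt_encard (t := closedBall G x (2 * s))
      ⟨fun y hy => hy.1, fun h => (h (center_mem G x _)).2 rfl⟩ |>.trans_le ?_
    exact (encard_closedBall_le hd x _).trans (by exact_mod_cast hn)
  obtain ⟨c, hcm, hc⟩ := exists_measurable_fin_coloring hF hFdeg
  have hinj : ∀ x, Set.InjOn c (closedBall G x s) := by
    intro x y hy z hz hyz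
    by_contra hne
    refine hc y z ⟨?_, hne⟩ hyz
    rw [two_mul]
    exact mem_closedBall_add (mem_closedBall_comm.1 hy) hz
  exact ⟨A.eval G c, A.measurable_eval hG hd hcm
    (fun x => (hinj x).mono (closedBall_mono G x (Nat.le_add_left _ _))),
    hA.solves_of_injOn hisol (fun x => hball x s) hinj⟩
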